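/- Let $G$ be a countable monoid, let $k$ be an algebraically closed field, and let $X,Y$ be algebraic groups over $k$, that is, group schemes of finite type over $k$; put $A=X(k)$, $B=Y(k)$. For a set $C$, let $G$ act on $C^G$ by $(g\star x)(h)=x(hg)$, and equip $C^G$ with the product of the discrete topologies. A subshift of $C^G$ is a $G$-invariant subset $\Sigma\subset C^G$ (not necessarily closed); for finite $E\subset G$ put $\Sigma_E=\{x|_E : x\in\Sigma\}\subset C^E$. A subshift of $C^G$ is of finite type if it equals $\{x\in C^G : (g\star x)|_D\in P \text{ for all } g\in G\}$ for some finite $D\subset G$ and some $P\subset C^D$. For a subshift $\Sigma\subset C^G$ and a set $C'$, a map $\tau\colon\Sigma\to C'^G$ is a cellular automaton if there are a finite set $M\subset G$ and a map $\mu\colon\Sigma_M\to C'$ (a local defining map) with $\tau(c)(g)=\mu((g\star c)|_M)$ for all $c\in\Sigma$, $g\in G$. A subshift is sofic if it is the image of a subshift of finite type, over an arbitrary alphabet, under a cellular automaton. Let $\Sigma\subset A^G$ be a closed algebraic group subshift, that is, a closed subshift such that for every finite $E\subset G$ the set $\Sigma_E$ is an algebraic subgroup of $A^E=X^E(k)$,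 i.e. the set of $k$-points of a closed subgroup scheme of $X^E$. Let $\tau\colon\Sigma\to B^G$ be an injective algebraic group cellular automaton, that is, an injective cellular automaton that has a local defining map $\mu\colon\Sigma_M\to B$ which is induced by a homomorphism of algebraic groups over $k$. Then for every subshift $\Delta\subset A^G$ with $\Delta\subset\Sigma$, the image $\tau(\Delta)\subset B^G$ is a subshift; it is of finite type if and only if $\Delta$ is of finite type, and it is sofic if and only if $\Delta$ is sofic. -/

import Mathlib

open CategoryTheory Limits MonoidalCategory AlgebraicGeometry

universe u v w

namespace SymbolicGroup

/-! ### Symbolic dynamics over a monoid universe -/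

section Symbolic

variable {G : Type v} [Monoid G] {A : Type u} {B : Type w}

/-- The Bernoulli right shift action `(g ⋆ x)(h) = x(hg)` of `G` on `A^G`. -/
def shift (g : G) (x : G → A) : G → A := fun h => x (h * g)

/-- A subshift of `A^G` is a `G`-invariant subset (closedness is not part of the definition). -/
def IsSubshift (S : Set (G → A)) : Prop :=
  ∀ (g : G), ∀ x ∈ S, shift g x ∈ S

/-- The restriction `S_E ⊆ A^E` of `S ⊆ A^G` to a finite subset `E` of `G`. -/
def restr (S : Set (G → A)) (E : Finset G) : Set (E → A) :=
  (fun (x : G → A) (e : E) => x e) '' S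

/-- Closedness in `A^G` for the prodiscrete topology: the product of the discrete topologies. -/
def IsProdiscreteClosed (S : Set (G → A)) : Prop :=
  @IsClosed (G → A) (@Pi.topologicalSpace G (fun _ => A) (fun _ => ⊥)) S

/-- The set `Σ(A^G; D, P)` of all `x ∈ A^G` such that `(g ⋆ x)|_D ∈ P` for all `g ∈ G`. -/
def sftOf (D : Finset G) (P : Set (D → A)) : Set (G → A) :=
  {x | ∀ g : G, (fun d : D => shift g x d) ∈ P}

/-- Subshifts of finite type. -/
def IsFiniteType (S : Set (G → A)) : Prop :=
  ∃ (D : Finset G) (P : Set (D → A)), S = sftOf D P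

theorem IsSubshift.shift_restrict_mem {S : Set (G → A)} (hS : IsSubshift S) (M : Finset G)
    (c : S) (g : G) : (fun m : M => shift g c.1 m) ∈ restr S M :=
  ⟨shift g c.1, hS g c.1 c.2, rfl⟩

/-- `μ : S_M → B` is a local defining map of `τ : S → B^G`, with memory set `M`:
`τ(c)(g) = μ((g ⋆ c)|_M)` for all `c ∈ S` and `g ∈ G`. -/
def IsLocalDefiningMap {S : Set (G → A)} (hS : IsSubshift S) (τ : S → G → B) (M : Finset G)
    (μ : restr S M → B) : Prop :=
  ∀ (c : S) (g : G), τ c g = μ ⟨fun m : M => shift g c.1 m, hS.shift_restrict_mem M c g⟩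

/-- Cellular automata `S → B^G` on a subshift `S ⊆ A^G`. -/
def IsCellularAutomaton {S : Set (G → A)} (hS : IsSubshift S) (τ : S → G → B) : Prop :=
  ∃ (M : Finset G) (μ : restr S M → B), IsLocalDefiningMap hS τ M μ

/-- Sofic subshifts: images of subshifts of finite type, over an arbitrary alphabet `C`, under
cellular automata. The universe of `C` is no restriction: the symbols that occur in one chosen
preimage of each element of `S` form an alphabet of at most `|A^G| * |G|` letters that suffices. -/
def IsSofic (S : Set (G → A)) : Prop :=
  ∃ (C : Type (max u v)) (W : Set (G → C)) (hW : IsSubshift W) (γ : W → G → A),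
    IsFiniteType W ∧ IsCellularAutomaton hW γ ∧ Set.range γ = S

/-- The image `τ(Δ)` of a subset `Δ` of the domain `S` of `τ`. -/
def imageOf {S : Set (G → A)} (τ : S → G → B) (Δ : Set (G → A)) : Set (G → B) :=
  τ '' {x : S | x.1 ∈ Δ}

end Symbolic

/-! ### Algebraic groups

An algebraic group over a field `k` is a group scheme of finite type over `k`. -/

section Algebraic

variable {k : Type u} [Field k]

/-- The set `X(k)` of `k`-points of a `k`-scheme `X`, i.e. of morphisms `Spec k ⟶ X` over `k`. -/
abbrev Points (X : Over (Spec (.of k))) : Type u :=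
  𝟙_ (Over (Spec (.of k))) ⟶ X

/-- `H` is a closed subgroup scheme of the power `X^E`, embedded by the morphism `H ⟶ X^E` with
components `p e`, and `S ⊆ X(k)^E` is its set of `k`-points. Since the group law of `X^E` is
componentwise, `H ⟶ X^E` is a homomorphism iff every `p e` is one. -/
structure IsPointsOfSubgroup {X : Over (Spec (.of k))} [GrpObj X] {E : Type v} [Finite E]
    (H : Over (Spec (.of k))) [GrpObj H] (p : E → (H ⟶ X)) (S : Set (E → Points X)) : Prop where
  isMonHom : ∀ e, IsMonHom (p e)
  isClosedImmersion : IsClosedImmersion (Pi.lift (f := fun _ : E => X) p).left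
  range_eq : Set.range (fun (h : Points H) (e : E) => h ≫ p e) = S

/-- `S ⊆ X(k)^E` is an algebraic subgroup of `X(k)^E`. -/
def IsAlgebraicSubgroup (X : Over (Spec (.of k))) [GrpObj X] {E : Type v} [Finite E]
    (S : Set (E → Points X)) : Prop :=
  ∃ (H : Over (Spec (.of k))) (_ : GrpObj H) (p : E → (H ⟶ X)), IsPointsOfSubgroup H p S

/-- `μ : S → Y(k)`, where `S ⊆ X(k)^E` is an algebraic subgroup, is the map on `k`-points of a
homomorphism `f` of algebraic groups over `k`. -/
def IsAlgebraicHom (X Y : Over (Spec (.of k))) [GrpObj X] [GrpObj Y] {E : Type v} [Finite E]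
    (S : Set (E → Points X)) (μ : S → Points Y) : Prop :=
  ∃ (H : Over (Spec (.of k))) (_ : GrpObj H) (p : E → (H ⟶ X)) (hp : IsPointsOfSubgroup H p S)
    (f : H ⟶ Y), IsMonHom f ∧
      ∀ h : Points H, μ ⟨fun e => h ≫ p e, hp.range_eq ▸ Set.mem_range_self h⟩ = h ≫ f

variable {G : Type v} [Monoid G]

/-- Closed algebraic group subshifts of `X(k)^G`. -/
structure IsClosedAlgebraicGroupSubshift (X : Over (Spec (.of k))) [GrpObj X]
    (S : Set (G → Points X)) : Prop where
  isSubshift : IsSubshift S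
  isClosed : IsProdiscreteClosed S
  isAlgebraicSubgroup : ∀ E : Finset G, IsAlgebraicSubgroup X (restr S E)

/-- Algebraic group cellular automata `S → Y(k)^G`: those with a local defining map which is a
homomorphism of algebraic groups. -/
def IsAlgebraicGroupCellularAutomaton (X Y : Over (Spec (.of k))) [GrpObj X] [GrpObj Y]
    {S : Set (G → Points X)} (hS : IsSubshift S) (τ : S → G → Points Y) : Prop :=
  ∃ (M : Finset G) (μ : restr S M → Points Y),
    IsLocalDefiningMap hS τ M μ ∧ IsAlgebraicHom X Y (restr S M) μ

end Algebraic

end SymbolicGroup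

open SymbolicGroup

/-!
Finite type and soficity pass between `Δ` and `τ(Δ)` as soon as the inverse of `τ` is a cellular
automaton: both properties are stable under sliding block maps that are injective on the subshift in
question, the finite type case by adding the (finitely supported) condition that the round trip
through the inverse is the identity. By equivariance, what is needed is a finite `N ⊆ G` such that
`τ(x)|_N` determines `x(1)`; by the group structure, such that `τ(x)|_N = 1` implies `x(1) = 1`
(`exists_finset_determines`).

Let `E n` be an increasing exhaustion of `G` by finite sets, and `K n` the group of `x ∈ S` with
`τ(x)|_{E n} = 1`. The intersection of all `K n` is trivial because `τ` is injective, and the issue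
is to see this already on the coordinate `1` at a finite stage. This is a Mittag-Leffler argument
(`exists_mem_forall_of_restr_stabilizes`), for which the restrictions `(K n)_F` to each finite
window `F` have to be eventually constant in `n`. They are subgroups of `X(k)^F`, which is Noetherian
for the Zariski topology, so it suffices that they are closed (`isClosed_restr_windowKernel`). Now
`(K n)_F` is the projection of a Zariski closed subset of a larger window, so it is constructible by
Chevalley's theorem (`isConstructible_image_reindex`), and a constructible subgroup is closed
(`isClosed_of_isConstructible_subgroup`). Since `k` is algebraically closed, `k`-points are the
closed points of a Jacobson scheme, which is how statements about schemes descend to `k`-points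
(`exists_comp_eq_of_mem_image`).
-/

namespace SymbolicGroup

/-! ### Constructible subgroups are closed -/

section ConstructibleSubgroup

/-- On any set `C`, a constructible set `s` is locally all or nothing: each nonempty relatively open
part of `C` has a nonempty relatively open part that is contained in `s` or disjoint from `s`. -/
theorem exists_isOpen_inter_subset_or_disjoint {T : Type*} [TopologicalSpace T] (C : Set T)
    {s : Set T} (hs : Topology.IsConstructible s) :
    ∀ U : Set T, IsOpen U → (U ∩ C).Nonempty → ∃ V : Set T, IsOpen V ∧ V ⊆ U ∧ (V ∩ C).Nonempty ∧
      (V ∩ C ⊆ s ∨ Disjoint (V ∩ C) s) := by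
  induction hs using Topology.IsConstructible.empty_union_induction with
  | open_retrocompact O hO _ =>
    intro U hU hUC
    by_cases h : (U ∩ O ∩ C).Nonempty
    · exact ⟨U ∩ O, hU.inter hO, Set.inter_subset_left, h, .inl fun x hx => hx.1.2⟩
    · refine ⟨U, hU, subset_rfl, hUC, .inr (Set.disjoint_left.2 fun x hx hxO => h ⟨x, ?_⟩)⟩
      exact ⟨⟨hx.1, hxO⟩, hx.2⟩
  | union s _ t _ ihs iht =>
    intro U hU hUC
    obtain ⟨V, hV, hVU, hVC, h | h⟩ := ihs U hU hUC
    · exact ⟨V, hV, hVU, hVC, .inl (h.trans Set.subset_union_left)⟩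
    · obtain ⟨W, hW, hWV, hWC, h' | h'⟩ := iht V hV hVC
      · exact ⟨W, hW, hWV.trans hVU, hWC, .inl (h'.trans Set.subset_union_right)⟩
      · exact ⟨W, hW, hWV.trans hVU, hWC, .inr (Set.disjoint_union_right.2
          ⟨h.mono_left (Set.inter_subset_inter_left C hWV), h'⟩)⟩
  | compl s _ ih =>
    intro U hU hUC
    obtain ⟨V, hV, hVU, hVC, h | h⟩ := ih U hU hUC
    · exact ⟨V, hV, hVU, hVC, .inr (Set.disjoint_compl_right_iff_subset.2 h)⟩
    · exact ⟨V, hV, hVU, hVC, .inl (Set.subset_compl_iff_disjoint_right.2 h)⟩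

/-- Multiplication need only be separately continuous, as it is for the Zariski topology. -/
theorem isClosed_of_isConstructible_subgroup {Γ : Type*} [Group Γ] [TopologicalSpace Γ]
    [SeparatelyContinuousMul Γ] [ContinuousInv Γ] (H : Subgroup Γ)
    (hH : Topology.IsConstructible (H : Set Γ)) : IsClosed (H : Set Γ) := by
  obtain ⟨V, hV, -, ⟨v, hvV, hvC⟩, h⟩ := exists_isOpen_inter_subset_or_disjoint
    (closure (H : Set Γ)) hH Set.univ isOpen_univ ⟨1, trivial, subset_closure H.one_mem⟩
  obtain ⟨a, haV, haH⟩ := mem_closure_iff.1 hvC V hV hvV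
  -- The subgroup is dense in its closure, so it contains a nonempty relatively open part of it.
  have hVH : V ∩ closure (H : Set Γ) ⊆ H :=
    h.resolve_right fun h => Set.disjoint_left.1 h ⟨haV, subset_closure haH⟩ haH
  refine isClosed_of_closure_subset fun c hc => ?_
  have hcont : Continuous fun y : Γ => a * (y⁻¹ * c) := by fun_prop
  obtain ⟨y, hyV, hyH⟩ := mem_closure_iff.1 hc _ (hV.preimage hcont) (by simpa using haV)
  have hay : a * y⁻¹ ∈ H := H.mul_mem haH (H.inv_mem hyH)
  have hmem : a * y⁻¹ * c ∈ closure (H : Set Γ) :=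
    map_mem_closure (continuous_const_mul (a * y⁻¹)) hc fun z hz => H.mul_mem hay hz
  have : a * y⁻¹ * c ∈ H := hVH ⟨by simpa [mul_assoc] using hyV, hmem⟩
  exact (H.mul_mem_cancel_left hay).1 this

end ConstructibleSubgroup

/-! ### Decreasing sequences of closed sets of configurations -/

section Prodiscrete

variable {G : Type v} {A : Type u}

theorem mem_of_forall_restr_mem {S : Set (G → A)} (hS : IsProdiscreteClosed S) {x : G → A}
    (hx : ∀ E : Finset G, (fun e : E => x e) ∈ restr S E) : x ∈ S := by
  let : TopologicalSpace A := ⊥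
  have hS' : IsClosed S := hS
  rw [← hS'.closure_eq, mem_closure_iff]
  intro O hO hxO
  obtain ⟨E, u, hu, hE⟩ := isOpen_pi_iff.1 hO x hxO
  obtain ⟨y, hyS, hy⟩ := hx E
  refine ⟨y, hE fun e he => ?_, hyS⟩
  have : y e = x e := congrFun hy ⟨e, he⟩
  rw [this]
  exact (hu e he).2

/-- A Mittag-Leffler argument: a pattern occurring in every term of a decreasing sequence of closed
sets of configurations occurs in their intersection, provided that for each finite window the
sequence of sets of patterns is eventually constant. -/
theorem exists_mem_forall_of_restr_stabilizes [Countable G] (K : ℕ → Set (G → A))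
    (hK : Antitone K)
    (hclosed : ∀ n (x : G → A), (∀ E : Finset G, (fun e : E => x e) ∈ restr (K n) E) → x ∈ K n)
    (hstab : ∀ E : Finset G, ∃ n, ∀ m, n ≤ m → restr (K n) E = restr (K m) E)
    (E : Finset G) (z : E → A) (hz : ∀ n, z ∈ restr (K n) E) :
    ∃ x, (∀ n, x ∈ K n) ∧ (fun e : E => x e) = z := by
  classical
  obtain ⟨e, he⟩ := Countable.exists_injective_nat G
  -- An increasing exhaustion `F` of `G` by finite sets that starts with `E`.
  let F : ℕ → Finset G := fun j => E ∪ ((Finset.range j).preimage e he.injOn)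
  have hF : Monotone F := fun i j hij => Finset.union_subset_union_right fun g hg => by
    simp only [Finset.mem_preimage, Finset.mem_range] at hg ⊢; omega
  have hF' : ∀ g, g ∈ F (e g + 1) := fun g => by simp [F]
  choose n hn using fun j => hstab (F j)
  let N : ℕ → ℕ := fun j => (Finset.range (j + 1)).sup n + j
  have hN : Monotone N := fun i j hij =>
    add_le_add (Finset.sup_mono (Finset.range_mono (by omega))) hij
  have hnN : ∀ j, n j ≤ N j := fun j =>
    (Finset.le_sup (f := n) (Finset.self_mem_range_succ j)).trans (Nat.le_add_right _ _)
  have hjN : ∀ j, j ≤ N j := fun j => Nat.le_add_left _ _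
  have hstep : ∀ (j : ℕ) (x : G → A), x ∈ K (N j) →
      ∃ y ∈ K (N (j + 1)), ∀ g ∈ F j, y g = x g := by
    intro j x hx
    have h1 : (fun g : F j => x g) ∈ restr (K (N (j + 1))) (F j) := by
      rw [← hn j _ ((hnN j).trans (hN j.le_succ)), hn j _ (hnN j)]
      exact ⟨x, hx, rfl⟩
    obtain ⟨y, hy, hyx⟩ := h1
    exact ⟨y, hy, fun g hg => congrFun hyx ⟨g, hg⟩⟩
  obtain ⟨x₀, hx₀, hx₀z⟩ := hz (N 0)
  choose next hnext hnext' using hstep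
  let X : ∀ j, {x // x ∈ K (N j)} := fun j =>
    Nat.rec ⟨x₀, hx₀⟩ (fun j x => ⟨next j x.1 x.2, hnext j x.1 x.2⟩) j
  have hX : ∀ i j, i ≤ j → ∀ g ∈ F i, (X j).1 g = (X i).1 g := by
    intro i j hij
    induction j, hij using Nat.le_induction with
    | base => exact fun _ _ => rfl
    | succ j hij ih => exact fun g hg => (hnext' j _ (X j).2 g (hF hij hg)).trans (ih g hg)
  let x : G → A := fun g => (X (e g + 1)).1 g
  have hx : ∀ j, ∀ g ∈ F j, x g = (X j).1 g := by
    intro j g hg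
    rcases le_total j (e g + 1) with h | h
    · exact hX _ _ h g hg
    · exact (hX _ _ h g (hF' g)).symm
  refine ⟨x, fun m => hclosed m x fun D => ?_, ?_⟩
  · let j := D.sup (fun g => e g + 1) + m
    refine ⟨(X j).1, hK ((Nat.le_add_left _ _).trans (hjN j)) (X j).2, funext fun d => ?_⟩
    refine (hx j d (hF ?_ (hF' d))).symm
    exact (Finset.le_sup (f := fun g => e g + 1) d.2).trans (Nat.le_add_right _ _)
  · rw [← hx₀z]
    exact funext fun g => hx 0 g (Finset.mem_union_left _ g.2)

end Prodiscrete

/-! ### Sliding block maps -/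

section Slide

variable {G : Type v} [Monoid G] {A : Type u} {B : Type w} {C : Type*}

theorem shift_shift (g h : G) (x : G → A) : shift h (shift g x) = shift (h * g) x :=
  funext fun t => congrArg x (mul_assoc t h g)

theorem shift_apply_one (g : G) (x : G → A) : shift g x 1 = x g := congrArg x (one_mul g)

/-- The `G`-equivariant map `A^G → B^G` whose value at `g` is obtained by applying the rule `f` to
the shift of the configuration by `g`. It is a cellular automaton on all of `A^G` when `f` depends
on finitely many coordinates only; rules are functions on `A^G` rather than on `A^M`, so that they
compose without bookkeeping of memory sets. -/
def slide (f : (G → A) → B) (x : G → A) : G → B := fun g => f (shift g x)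

theorem slide_shift (f : (G → A) → B) (g : G) (x : G → A) :
    slide f (shift g x) = shift g (slide f x) :=
  funext fun h => congrArg f (shift_shift g h x)

theorem slide_comp_slide (f : (G → B) → C) (h : (G → A) → B) (x : G → A) :
    slide (fun y => f (slide h y)) x = slide f (slide h x) :=
  funext fun g => congrArg f (slide_shift h g x)

open scoped Pointwise in
theorem dependsOn_comp_slide {f : (G → B) → C} {h : (G → A) → B} {M N : Set G}
    (hf : DependsOn f M) (hh : DependsOn h N) : DependsOn (fun x => f (slide h x)) (N * M) :=
  fun _ _ hxy => hf fun _ hm => hh fun _ hn => hxy _ (Set.mul_mem_mul hn hm)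

theorem IsSubshift.image_slide {S : Set (G → A)} (hS : IsSubshift S) (f : (G → A) → B) :
    IsSubshift (slide f '' S) := by
  rintro g _ ⟨x, hx, rfl⟩
  exact ⟨shift g x, hS g x hx, slide_shift f g x⟩

theorem isFiniteType_iff {S : Set (G → A)} :
    IsFiniteType S ↔ ∃ (D : Finset G) (Q : (G → A) → Prop),
      DependsOn Q (D : Set G) ∧ S = {x | ∀ g, Q (shift g x)} := by
  constructor
  · rintro ⟨D, P, rfl⟩
    refine ⟨D, fun x => (fun d : D => x d) ∈ P, fun x y hxy => ?_, rfl⟩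
    have : (fun d : D => x d) = fun d : D => y d := funext fun d => hxy d d.2
    simp only [this]
  · rintro ⟨D, Q, hQ, rfl⟩
    refine ⟨D, (fun (x : G → A) (d : D) => x d) '' {x | Q x}, Set.ext fun x => forall_congr' ?_⟩
    refine fun g => ⟨fun h => ⟨_, h, rfl⟩, ?_⟩
    rintro ⟨y, hy, hyx⟩
    exact (hQ fun d hd => congrFun hyx ⟨d, hd⟩).mp hy

theorem isCellularAutomaton_iff [Nonempty B] {S : Set (G → A)} (hS : IsSubshift S)
    (τ : S → G → B) :
    IsCellularAutomaton hS τ ↔ ∃ (M : Finset G) (f : (G → A) → B),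
      DependsOn f (M : Set G) ∧ ∀ c : S, τ c = slide f c := by
  classical
  constructor
  · rintro ⟨M, μ, hμ⟩
    refine ⟨M, fun x => if h : (fun m : M => x m) ∈ restr S M then μ ⟨_, h⟩ else
      Classical.arbitrary B, fun x y hxy => ?_, fun c => funext fun g => ?_⟩
    · have : (fun m : M => x m) = fun m : M => y m := funext fun m => hxy m m.2
      simp only [this]
    · rw [hμ c g, slide, dif_pos (hS.shift_restrict_mem M c g)]
  · rintro ⟨M, f, hf, h⟩
    refine ⟨M, fun p => f p.2.choose, fun c g => ?_⟩
    rw [h c]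
    refine hf fun m hm => ?_
    exact (congrFun (hS.shift_restrict_mem M c g).choose_spec.2 ⟨m, hm⟩).symm

/-- The image under an injective sliding block map is cut out by finitely supported conditions:
`y` is in the image iff the inverse rule sends `y` into `S` and the round trip fixes `y`. -/
theorem IsFiniteType.image_slide {S : Set (G → A)} (hS : IsFiniteType S)
    {f : (G → A) → B} {h : (G → B) → A} {M N : Finset G} (hf : DependsOn f (M : Set G))
    (hh : DependsOn h (N : Set G)) (hinv : ∀ x ∈ S, slide h (slide f x) = x) :
    IsFiniteType (slide f '' S) := by
  classical
  open scoped Pointwise in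
  obtain ⟨D, Q, hQ, rfl⟩ := isFiniteType_iff.1 hS
  refine isFiniteType_iff.2 ⟨N * D ∪ (N * M ∪ {1}),
    fun y => Q (slide h y) ∧ f (slide h y) = y 1, fun y z hyz => ?_, Set.ext fun y => ?_⟩
  · have h1 := dependsOn_comp_slide hQ hh (x := y) (y := z) fun i hi => hyz i (by
      push_cast; exact .inl hi)
    have h2 := dependsOn_comp_slide hf hh (x := y) (y := z) fun i hi => hyz i (by
      push_cast; exact .inr (.inl hi))
    have h3 : y 1 = z 1 := hyz 1 (by simp)
    simp only [h1, h2, h3]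
  · constructor
    · rintro ⟨x, hx, rfl⟩ g
      simp only [slide_shift, hinv x hx, shift_apply_one]
      exact ⟨hx g, rfl⟩
    · intro hy
      refine ⟨slide h y, fun g => ?_, funext fun g => ?_⟩
      · rw [← slide_shift]; exact (hy g).1
      · have := (hy g).2
        rwa [slide_shift, shift_apply_one] at this

theorem IsSofic.image_slide {A B : Type u} [Nonempty A] [Nonempty B] {S : Set (G → A)}
    (hS : IsSofic S) {f : (G → A) → B} {M : Finset G} (hf : DependsOn f (M : Set G)) :
    IsSofic (slide f '' S) := by
  classical
  open scoped Pointwise in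
  obtain ⟨C, W, hW, γ, hWF, hγ, rfl⟩ := hS
  obtain ⟨N, h, hh, hγh⟩ := (isCellularAutomaton_iff hW γ).1 hγ
  refine ⟨C, W, hW, fun c => slide f (γ c), hWF, (isCellularAutomaton_iff hW _).2
    ⟨N * M, fun x => f (slide h x), ?_, fun c => ?_⟩, Set.range_comp (slide f) γ⟩
  · push_cast; exact dependsOn_comp_slide hf hh
  · rw [hγh c, slide_comp_slide]

/-- A set `N` such that the restriction of `τ(x)` to `N` determines `x(1)` is a memory set of the
inverse of `τ`, so `τ` transports finite type and soficity both ways. -/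
theorem imageOf_iff_of_determined {A B : Type u} [Nonempty A] [Nonempty B] {S : Set (G → A)}
    (hS : IsSubshift S) (τ : S → G → B) (hτ : IsCellularAutomaton hS τ) (N : Finset G)
    (hN : ∀ x y : S, (∀ n ∈ N, τ x n = τ y n) → x.1 1 = y.1 1)
    (Δ : Set (G → A)) (hΔ : IsSubshift Δ) (hΔS : Δ ⊆ S) :
    IsSubshift (imageOf τ Δ) ∧
      (IsFiniteType (imageOf τ Δ) ↔ IsFiniteType Δ) ∧
      (IsSofic (imageOf τ Δ) ↔ IsSofic Δ) := by
  obtain ⟨M, f, hf, hτf⟩ := (isCellularAutomaton_iff hS τ).1 hτ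
  have himage : imageOf τ Δ = slide f '' Δ := by
    ext y
    constructor
    · rintro ⟨x, hx, rfl⟩; exact ⟨x, hx, (hτf x).symm⟩
    · rintro ⟨x, hx, rfl⟩; exact ⟨⟨x, hΔS hx⟩, hx, hτf _⟩
  let h : (G → B) → A := fun y =>
    Classical.epsilon (fun x => x ∈ S ∧ ∀ n ∈ N, slide f x n = y n) 1
  have hh : DependsOn h (N : Set G) := fun y z hyz => by
    have : (fun x => x ∈ S ∧ ∀ n ∈ N, slide f x n = y n) =
        fun x => x ∈ S ∧ ∀ n ∈ N, slide f x n = z n :=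
      funext fun x => propext (and_congr_right fun _ => forall₂_congr fun n hn => by
        rw [hyz n hn])
    simp only [h, this]
  have hinv : ∀ x ∈ S, slide h (slide f x) = x := fun x hx => funext fun g => by
    have hg : shift g x ∈ S := hS g x hx
    have hex : ∃ z, z ∈ S ∧ ∀ n ∈ N, slide f z n = slide f (shift g x) n := ⟨_, hg, fun _ _ => rfl⟩
    obtain ⟨h1, h2⟩ := Classical.epsilon_spec hex
    have := hN ⟨_, h1⟩ ⟨_, hg⟩ fun n hn => by rw [hτf, hτf]; exact h2 n hn
    change h (shift g (slide f x)) = x g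
    rw [← slide_shift, ← shift_apply_one g x]
    exact this
  have hback : slide h '' (slide f '' Δ) = Δ := by
    rw [Set.image_image, Set.image_congr fun x hx => hinv x (hΔS hx), Set.image_id']
  rw [himage]
  refine ⟨hΔ.image_slide f, ⟨fun H => ?_, fun H => ?_⟩, ⟨fun H => ?_, fun H => ?_⟩⟩
  · rw [← hback]
    refine H.image_slide hh hf ?_
    rintro _ ⟨x, hx, rfl⟩
    rw [hinv x (hΔS hx)]
  · exact H.image_slide hf hh fun x hx => hinv x (hΔS hx)
  · rw [← hback]; exact H.image_slide hh
  · exact H.image_slide hf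

end Slide

/-! ### The Zariski topology on rational points -/

section Points

variable {k : Type u} [Field k]

/-- The point of the underlying space of `T` at which a `k`-point of `T` is centred. -/
noncomputable def center {T : Over (Spec (.of k))} (x : Points T) : T.left :=
  x.left (IsLocalRing.closedPoint k)

theorem center_comp {T T' : Over (Spec (.of k))} (x : Points T) (φ : T ⟶ T') :
    center (x ≫ φ) = φ.left (center x) :=
  Scheme.Hom.comp_apply x.left φ.left _

variable [IsAlgClosed k]

theorem center_injective {T : Over (Spec (.of k))} [LocallyOfFiniteType T.hom] :
    Function.Injective (center : Points T → T.left) := fun x y hxy =>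
  Over.OverMorphism.ext (ext_of_apply_closedPoint_eq T.hom (Over.w x) (Over.w y) hxy)

theorem exists_center_eq {T : Over (Spec (.of k))} [LocallyOfFiniteType T.hom] {t : T.left}
    (ht : IsClosed {t}) : ∃ x : Points T, center x = t :=
  ⟨Over.homMk (pointOfClosedPoint T.hom t ht) (pointOfClosedPoint_comp T.hom t ht),
    pointOfClosedPoint_apply T.hom t ht _⟩

theorem isClosed_center {T : Over (Spec (.of k))} [LocallyOfFiniteType T.hom] (x : Points T) :
    IsClosed {center x} :=
  (pointEquivClosedPoint T.hom ⟨x.left, Over.w x⟩ : closedPoints T.left).2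

/-- A `k`-point in the image of a closed subset of `T` lifts to a `k`-point of that subset: the
fibre is closed and nonempty, and `T` is a Jacobson space. -/
theorem exists_comp_eq_of_mem_image {T T' : Over (Spec (.of k))} [LocallyOfFiniteType T.hom]
    [LocallyOfFiniteType T'.hom] (φ : T ⟶ T') {K : Set T.left} (hK : IsClosed K) (y : Points T')
    (hy : center y ∈ φ.left '' K) : ∃ x : Points T, center x ∈ K ∧ x ≫ φ = y := by
  have := LocallyOfFiniteType.jacobsonSpace T.hom
  obtain ⟨t, htK, hty⟩ := hy
  have hne : (K ∩ φ.left ⁻¹' {center y}).Nonempty := ⟨t, htK, hty⟩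
  obtain ⟨s, ⟨hsK, hsy⟩, hs⟩ := nonempty_inter_closedPoints hne
    (hK.inter ((isClosed_center y).preimage φ.left.continuous)).isLocallyClosed
  obtain ⟨x, rfl⟩ := exists_center_eq hs
  exact ⟨x, hsK, center_injective ((center_comp x φ).trans hsy)⟩

end Points

/-! ### Powers of an algebraic group -/

section Power

variable {k : Type u} [Field k]

/-- The structure morphism of a finite power inherits properties stable under base change and
composition. -/
theorem prop_power_hom (P : MorphismProperty Scheme.{u}) [P.ContainsIdentities]
    [P.IsStableUnderBaseChange] [P.IsStableUnderComposition] (X : Over (Spec (.of k)))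
    (hX : P X.hom) (E : Type v) [Finite E] : P (∏ᶜ fun _ : E => X).hom := by
  let Q : ObjectProperty (Over (Spec (.of k))) := P.overObj
  have : Q.IsClosedUnderIsomorphisms := inferInstanceAs P.overObj.IsClosedUnderIsomorphisms
  have : Q.IsClosedUnderLimitsOfShape (Discrete PEmpty.{1}) :=
    Over.closedUnderLimitsOfShape_discrete_empty P
  have : Q.IsClosedUnderBinaryProducts := by
    refine ⟨fun Z ⟨hZ⟩ => ?_⟩
    let U := hZ.diag.obj ⟨.left⟩
    let V := hZ.diag.obj ⟨.right⟩
    have hUV : Q (U ⊗ V) := P.comp_mem _ _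
      (P.pullback_fst U.hom V.hom (hZ.prop_diag_obj ⟨.right⟩)) (hZ.prop_diag_obj ⟨.left⟩)
    refine Q.prop_of_iso ?_ hUV
    exact (CartesianMonoidalCategory.tensorProductIsBinaryProduct U V).conePointsIsoOfNatIso
      hZ.isLimit (diagramIsoPair hZ.diag).symm
  have : Q.IsClosedUnderFiniteProducts := .mk'
  exact Q.prop_pi (fun _ : E => X) fun _ => hX

instance locallyOfFiniteType_power (X : Over (Spec (.of k))) [LocallyOfFiniteType X.hom]
    (E : Type v) [Finite E] : LocallyOfFiniteType (∏ᶜ fun _ : E => X).hom :=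
  have : MorphismProperty.ContainsIdentities @LocallyOfFiniteType := ⟨fun _ => inferInstance⟩
  prop_power_hom @LocallyOfFiniteType X ‹_› E

instance quasiCompact_power (X : Over (Spec (.of k))) [QuasiCompact X.hom]
    (E : Type v) [Finite E] : QuasiCompact (∏ᶜ fun _ : E => X).hom :=
  have : MorphismProperty.ContainsIdentities @QuasiCompact := ⟨fun _ => inferInstance⟩
  prop_power_hom @QuasiCompact X ‹_› E

/-- The `k`-point of the power `X^E` with coordinates `z`. -/
noncomputable abbrev powerPoint {X : Over (Spec (.of k))} {E : Type v} [Finite E]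
    (z : E → Points X) : Points (∏ᶜ fun _ : E => X) :=
  Pi.lift z

theorem exists_powerPoint_eq {X : Over (Spec (.of k))} {E : Type v} [Finite E]
    (x : Points (∏ᶜ fun _ : E => X)) : ∃ z : E → Points X, powerPoint z = x :=
  ⟨fun e => x ≫ Pi.π _ e, Pi.hom_ext _ _ fun e => Pi.lift_π _ e⟩

/-- The Zariski topology of `X(k)^E`, induced by the underlying space of the power `X^E`; in general
it is finer than the product of the Zariski topologies of the factors. -/
@[reducible]
noncomputable def zariskiTopology (X : Over (Spec (.of k))) (E : Type v) [Finite E] :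
    TopologicalSpace (E → Points X) :=
  .induced (fun z => center (powerPoint z)) inferInstance

attribute [local instance] zariskiTopology

theorem continuous_of_morphism {X Y : Over (Spec (.of k))} {E F : Type v} [Finite E] [Finite F]
    (φ : (∏ᶜ fun _ : E => X) ⟶ ∏ᶜ fun _ : F => Y) {f : (E → Points X) → F → Points Y}
    (hf : ∀ z, powerPoint z ≫ φ = powerPoint (f z)) : Continuous f := by
  refine continuous_induced_rng.2 ?_
  have : (fun z => center (powerPoint z)) ∘ f = fun z => φ.left (center (powerPoint z)) :=
    funext fun z => by rw [Function.comp_apply, ← hf, center_comp]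
  rw [this]
  exact φ.left.continuous.comp continuous_induced_dom

/-- The morphism of powers of `X` that permutes, repeats or forgets coordinates along `r`. -/
noncomputable def powerReindex (X : Over (Spec (.of k))) {E F : Type v} [Finite E] [Finite F]
    (r : F → E) : (∏ᶜ fun _ : E => X) ⟶ ∏ᶜ fun _ : F => X :=
  Pi.lift fun i => Pi.π _ (r i)

theorem powerPoint_comp_powerReindex {X : Over (Spec (.of k))} {E F : Type v} [Finite E] [Finite F]
    (r : F → E) (z : E → Points X) :
    powerPoint z ≫ powerReindex X r = powerPoint fun i => z (r i) :=
  Pi.hom_ext _ _ fun i => by simp [powerReindex, powerPoint]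

theorem continuous_reindex (X : Over (Spec (.of k))) {E F : Type v} [Finite E] [Finite F]
    (r : F → E) : Continuous fun (z : E → Points X) i => z (r i) :=
  continuous_of_morphism _ (powerPoint_comp_powerReindex r)

section Group

open SemiCartesianMonoidalCategory
open scoped MonObj

variable (X : Over (Spec (.of k))) [GrpObj X] (E : Type v) [Finite E]

theorem separatelyContinuousMul : SeparatelyContinuousMul (E → Points X) where
  continuous_const_mul {a} := continuous_of_morphism
    (Pi.lift fun e => (toUnit _ ≫ a e) * Pi.π (fun _ : E => X) e) fun z =>
      Pi.hom_ext _ _ fun e => by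
        simp [powerPoint, MonObj.comp_mul]
  continuous_mul_const {a} := continuous_of_morphism
    (Pi.lift fun e => Pi.π (fun _ : E => X) e * (toUnit _ ≫ a e)) fun z =>
      Pi.hom_ext _ _ fun e => by
        simp [powerPoint, MonObj.comp_mul]

theorem continuousInv : ContinuousInv (E → Points X) where
  continuous_inv := continuous_of_morphism (Pi.lift fun e => (Pi.π (fun _ : E => X) e)⁻¹) fun z =>
      Pi.hom_ext _ _ fun e => by simp [powerPoint, GrpObj.comp_inv]

end Group

theorem noetherianSpace (X : Over (Spec (.of k))) [LocallyOfFiniteType X.hom] [QuasiCompact X.hom]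
    (E : Type v) [Finite E] : TopologicalSpace.NoetherianSpace (E → Points X) := by
  let T := ∏ᶜ fun _ : E => X
  have : IsLocallyNoetherian T.left := LocallyOfFiniteType.isLocallyNoetherian T.hom
  have : CompactSpace T.left := (quasiCompact_iff_compactSpace T.hom).1 inferInstance
  have : IsNoetherian T.left := {}
  exact Topology.IsInducing.noetherianSpace (i := fun z => center (powerPoint z)) ⟨rfl⟩

variable [IsAlgClosed k]

/-- Chevalley's theorem for the `k`-points of powers of `X`. -/
theorem isConstructible_image_reindex (X : Over (Spec (.of k))) [LocallyOfFiniteType X.hom]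
    [QuasiCompact X.hom] {E F : Type v} [Finite E] [Finite F] (r : F → E)
    {Z : Set (E → Points X)} (hZ : IsClosed Z) :
    Topology.IsConstructible ((fun (z : E → Points X) i => z (r i)) '' Z) := by
  let T := ∏ᶜ fun _ : E => X
  let T' := ∏ᶜ fun _ : F => X
  let φ : T ⟶ T' := powerReindex X r
  have := noetherianSpace X F
  have : IsLocallyNoetherian T'.left := LocallyOfFiniteType.isLocallyNoetherian T'.hom
  have : CompactSpace T'.left := (quasiCompact_iff_compactSpace T'.hom).1 inferInstance
  have : IsLocallyNoetherian T.left := LocallyOfFiniteType.isLocallyNoetherian T.hom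
  have : CompactSpace T.left := (quasiCompact_iff_compactSpace T.hom).1 inferInstance
  have : IsNoetherian T.left := {}
  have : LocallyOfFiniteType (φ.left ≫ T'.hom) := by rw [Over.w]; infer_instance
  have : LocallyOfFiniteType φ.left := locallyOfFiniteType_of_comp φ.left T'.hom
  obtain ⟨K, hK, rfl⟩ := isClosed_induced_iff.1 hZ
  have hKc : Topology.IsConstructible K := by
    have : Topology.IsConstructible Kᶜ :=
      (TopologicalSpace.NoetherianSpace.isCompact _).isConstructible hK.isOpen_compl
    simpa using this.compl
  have himage : (fun (z : E → Points X) i => z (r i)) '' ((fun z => center (powerPoint z)) ⁻¹' K) =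
      (fun z => center (powerPoint z)) ⁻¹' (φ.left '' K) := by
    ext y
    constructor
    · rintro ⟨z, hz, rfl⟩
      refine ⟨_, hz, ?_⟩
      rw [← center_comp, powerPoint_comp_powerReindex]
    · intro hy
      obtain ⟨x, hxK, hxy⟩ := exists_comp_eq_of_mem_image φ hK (powerPoint y) hy
      obtain ⟨z, rfl⟩ := exists_powerPoint_eq x
      refine ⟨z, hxK, ?_⟩
      rw [powerPoint_comp_powerReindex] at hxy
      exact funext fun i => by simpa [powerPoint] using congrArg (· ≫ Pi.π _ i) hxy
  rw [himage]
  exact (φ.left.isConstructible_image hKc).preimage continuous_induced_dom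
    fun _ _ _ _ _ _ => TopologicalSpace.NoetherianSpace.isCompact _

/-- The `k`-points of a closed subscheme `K` of a closed subgroup scheme `H` of `X^E` form a closed
subset of `X(k)^E`. -/
theorem isClosed_image_of_isPointsOfSubgroup {X : Over (Spec (.of k))} [GrpObj X]
    [LocallyOfFiniteType X.hom] {E : Type v} [Finite E] {H : Over (Spec (.of k))} [GrpObj H]
    {p : E → (H ⟶ X)} {S : Set (E → Points X)} (hp : IsPointsOfSubgroup H p S)
    {K : Set H.left} (hK : IsClosed K) :
    IsClosed ((fun (h : Points H) (e : E) => h ≫ p e) '' (center ⁻¹' K)) := by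
  let T := ∏ᶜ fun _ : E => X
  let φ : H ⟶ T := Pi.lift p
  have : IsClosedImmersion φ.left := hp.isClosedImmersion
  have : LocallyOfFiniteType H.hom := by rw [← Over.w φ]; infer_instance
  refine isClosed_induced_iff.2 ⟨φ.left '' K, φ.left.isClosedEmbedding.isClosedMap K hK, ?_⟩
  have hφ : ∀ h : Points H, h ≫ φ = powerPoint fun e => h ≫ p e := fun h =>
    Pi.hom_ext _ _ fun e => by simp [φ, powerPoint]
  ext y
  constructor
  · intro hy
    obtain ⟨x, hxK, hxy⟩ := exists_comp_eq_of_mem_image φ hK (powerPoint y) hy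
    refine ⟨x, hxK, funext fun e => ?_⟩
    simpa [φ, powerPoint] using congrArg (· ≫ Pi.π _ e) hxy
  · rintro ⟨h, hh, rfl⟩
    exact ⟨center h, hh, by rw [← center_comp, hφ]⟩

end Power
/-! ### Kernels of algebraic group cellular automata -/

section Kernel

open scoped MonObj

variable {k : Type u} [Field k]

theorem exists_subgroup_of_isAlgebraicSubgroup {X : Over (Spec (.of k))} [GrpObj X] {E : Type v}
    [Finite E] {S : Set (E → Points X)} (hS : IsAlgebraicSubgroup X S) :
    ∃ L : Subgroup (E → Points X), (L : Set (E → Points X)) = S := by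
  obtain ⟨H, _, p, hp⟩ := hS
  have := hp.isMonHom
  let φ : Points H →* (E → Points X) :=
    { toFun := fun h e => h ≫ p e
      map_one' := funext fun e => MonObj.one_comp (p e)
      map_mul' := fun a b => funext fun e => MonObj.mul_comp a b (p e) }
  exact ⟨φ.range, hp.range_eq⟩

variable {G : Type v}

/-- Closedness lets group membership be tested on finite windows, where it holds by assumption. -/
theorem exists_subgroup_of_forall_restr {X : Over (Spec (.of k))} [GrpObj X]
    {S : Set (G → Points X)} (hS : IsProdiscreteClosed S)
    (hE : ∀ E : Finset G, IsAlgebraicSubgroup X (restr S E)) :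
    ∃ L : Subgroup (G → Points X), (L : Set (G → Points X)) = S := by
  choose L hL using fun E => exists_subgroup_of_isAlgebraicSubgroup (hE E)
  have hmem : ∀ x ∈ S, ∀ E : Finset G, (fun e : E => x e) ∈ L E := fun x hx E => by
    rw [← SetLike.mem_coe, hL]; exact ⟨x, hx, rfl⟩
  have hof : ∀ x : G → Points X, (∀ E : Finset G, (fun e : E => x e) ∈ L E) → x ∈ S := fun x hx =>
    mem_of_forall_restr_mem hS fun E => by rw [← hL]; exact hx E
  exact ⟨{ carrier := S
           mul_mem' := fun hx hy => hof _ fun E => (L E).mul_mem (hmem _ hx E) (hmem _ hy E)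
           one_mem' := hof _ fun E => (L E).one_mem
           inv_mem' := fun hx => hof _ fun E => (L E).inv_mem (hmem _ hx E) }, rfl⟩

theorem IsAlgebraicHom.map_mul {X Y : Over (Spec (.of k))} [GrpObj X] [GrpObj Y] {E : Type v}
    [Finite E] {S : Set (E → Points X)} {ν : S → Points Y} (hν : IsAlgebraicHom X Y S ν)
    (a b c : S) (h : c.1 = a.1 * b.1) : ν c = ν a * ν b := by
  obtain ⟨H, _, p, hp, f, _, hf⟩ := hν
  have := hp.isMonHom
  have hlift : ∀ s : S, ∃ t : Points H, (fun e => t ≫ p e) = s.1 := fun s =>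
    Set.mem_range.1 (hp.range_eq.ge s.2)
  obtain ⟨x, hx⟩ := hlift a
  obtain ⟨y, hy⟩ := hlift b
  obtain rfl : a = ⟨fun e => x ≫ p e, hp.range_eq ▸ Set.mem_range_self x⟩ := Subtype.ext hx.symm
  obtain rfl : b = ⟨fun e => y ≫ p e, hp.range_eq ▸ Set.mem_range_self y⟩ := Subtype.ext hy.symm
  obtain rfl : c = ⟨fun e => (x * y) ≫ p e, hp.range_eq ▸ Set.mem_range_self (x * y)⟩ :=
    Subtype.ext (h.trans (funext fun e => (MonObj.mul_comp x y (p e)).symm))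
  rw [hf, hf, hf, MonObj.mul_comp]

attribute [local instance] zariskiTopology

section IsAlgClosed

variable [IsAlgClosed k]

theorem IsAlgebraicSubgroup.isClosed {X : Over (Spec (.of k))} [GrpObj X]
    [LocallyOfFiniteType X.hom] {E : Type v} [Finite E] {S : Set (E → Points X)}
    (hS : IsAlgebraicSubgroup X S) : IsClosed S := by
  obtain ⟨H, _, p, hp⟩ := hS
  simpa [hp.range_eq] using isClosed_image_of_isPointsOfSubgroup hp isClosed_univ

/-- The kernel is taken on `k`-points, where it is the trace of the closed fibre over the neutral
element; no scheme-theoretic kernel is needed. -/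
theorem IsAlgebraicHom.isClosed_ker {X Y : Over (Spec (.of k))} [GrpObj X] [GrpObj Y]
    [LocallyOfFiniteType X.hom] [LocallyOfFiniteType Y.hom] {E : Type v} [Finite E]
    {S : Set (E → Points X)} {ν : S → Points Y} (hν : IsAlgebraicHom X Y S ν) :
    IsClosed {z | ∃ hz : z ∈ S, ν ⟨z, hz⟩ = 1} := by
  obtain ⟨H, _, p, hp, f, _, hf⟩ := hν
  have hK : IsClosed (f.left ⁻¹' {center (1 : Points Y)}) :=
    (isClosed_center _).preimage f.left.continuous
  convert isClosed_image_of_isPointsOfSubgroup hp hK using 1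
  have hiff : ∀ h : Points H, f.left (center h) = center (1 : Points Y) ↔ h ≫ f = 1 := fun h => by
    rw [← center_comp, center_injective.eq_iff]
  ext z
  constructor
  · rintro ⟨hz, h1⟩
    obtain ⟨h, rfl⟩ : z ∈ Set.range fun (h : Points H) (e : E) => h ≫ p e := hp.range_eq ▸ hz
    exact ⟨h, (hiff h).2 ((hf h).symm.trans h1), rfl⟩
  · rintro ⟨h, hh, rfl⟩
    exact ⟨hp.range_eq ▸ Set.mem_range_self h, (hf h).trans ((hiff h).1 hh)⟩

end IsAlgClosed

theorem exists_forall_eq_of_antitone {T : Type*} [TopologicalSpace T]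
    [TopologicalSpace.NoetherianSpace T] (Z : ℕ → Set T) (hZ : Antitone Z)
    (hclosed : ∀ n, IsClosed (Z n)) : ∃ n, ∀ m, n ≤ m → Z n = Z m := by
  let f : ℕ →o TopologicalSpace.Opens T :=
    ⟨fun n => ⟨(Z n)ᶜ, (hclosed n).isOpen_compl⟩, fun i j hij => Set.compl_subset_compl.2 (hZ hij)⟩
  obtain ⟨n, hn⟩ := WellFoundedGT.monotone_chain_condition f
  exact ⟨n, fun m hm => compl_injective (congrArg (fun U => U.1) (hn m hm))⟩

theorem restr_eq_image_restr {A : Type*} (S : Set (G → A)) {F F' : Finset G} (h : F ⊆ F') :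
    restr S F = (fun (z : F' → A) (i : F) => z ⟨i, h i.2⟩) '' restr S F' :=
  (Set.image_image (fun (z : F' → A) (i : F) => z ⟨i, h i.2⟩) (fun (x : G → A) (i : F') => x i)
    S).symm

variable {X Y : Over (Spec (.of k))} [GrpObj Y]

/-- The configurations of the domain of `τ` whose image under `τ` is trivial on `E`. -/
def windowKernel {S : Set (G → Points X)} (τ : S → G → Points Y) (E : Finset G) :
    Set (G → Points X) :=
  {x | ∃ hx : x ∈ S, ∀ e ∈ E, τ ⟨x, hx⟩ e = 1}

theorem exists_subgroup_eq_windowKernel [GrpObj X] (L : Subgroup (G → Points X))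
    (T : L →* (G → Points Y)) (E : Finset G) :
    ∃ K : Subgroup (G → Points X), (K : Set (G → Points X)) =
      windowKernel (S := (L : Set (G → Points X))) (fun x => T x) E := by
  let ρ : (G → Points Y) →* (E → Points Y) :=
    { toFun := fun x i => x i, map_one' := rfl, map_mul' := fun _ _ => rfl }
  refine ⟨(ρ.comp T).ker.map L.subtype, Set.ext fun x => ⟨?_, ?_⟩⟩
  · rintro ⟨y, hy, rfl⟩
    exact ⟨y.2, fun e he => congrFun (MonoidHom.mem_ker.1 hy) ⟨e, he⟩⟩
  · rintro ⟨hx, h1⟩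
    exact ⟨⟨x, hx⟩, MonoidHom.mem_ker.2 (funext fun e => h1 e e.2), rfl⟩

variable [Monoid G]

theorem restr_windowKernel {S : Set (G → Points X)} {hS : IsSubshift S} {τ : S → G → Points Y}
    {M : Finset G} {ν : restr S M → Points Y} (hν : IsLocalDefiningMap hS τ M ν)
    (E F : Finset G) (hF : ∀ m ∈ M, ∀ e ∈ E, m * e ∈ F) :
    restr (windowKernel τ E) F = restr S F ∩ ⋂ e : E,
      (fun (z : F → Points X) (m : M) => z ⟨m * e, hF m m.2 e e.2⟩) ⁻¹'
        {z | ∃ hz : z ∈ restr S M, ν ⟨z, hz⟩ = 1} := by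
  ext z
  simp only [Set.mem_inter_iff, Set.mem_iInter, Set.mem_preimage, Set.mem_ofPred_eq]
  constructor
  · rintro ⟨x, ⟨hx, h1⟩, rfl⟩
    refine ⟨⟨x, hx, rfl⟩, fun e => ⟨hS.shift_restrict_mem M ⟨x, hx⟩ e, ?_⟩⟩
    exact (hν ⟨x, hx⟩ e).symm.trans (h1 e e.2)
  · rintro ⟨⟨x, hx, rfl⟩, h⟩
    refine ⟨x, ⟨hx, fun e he => ?_⟩, rfl⟩
    obtain ⟨hz, h1⟩ := h ⟨e, he⟩
    exact (hν ⟨x, hx⟩ e).trans h1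

theorem mem_windowKernel_of_forall_restr {S : Set (G → Points X)} {hS : IsSubshift S}
    (hclosed : IsProdiscreteClosed S) {τ : S → G → Points Y} {M : Finset G}
    {ν : restr S M → Points Y} (hν : IsLocalDefiningMap hS τ M ν) (E : Finset G) {x : G → Points X}
    (hx : ∀ F : Finset G, (fun e : F => x e) ∈ restr (windowKernel τ E) F) :
    x ∈ windowKernel τ E := by
  classical
  have hxS : x ∈ S := mem_of_forall_restr_mem hclosed fun F =>
    Set.image_mono (fun _ h => h.1) (hx F)
  refine ⟨hxS, fun e he => ?_⟩
  obtain ⟨y, ⟨hy, hy1⟩, hyx⟩ := hx (M.image (· * e))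
  have hxy : (fun m : M => shift e x m) = fun m : M => shift e y m := funext fun m =>
    (congrFun hyx ⟨m * e, Finset.mem_image_of_mem _ m.2⟩).symm
  rw [← hy1 e he, hν, hν]
  exact congrArg ν (Subtype.ext hxy)

variable [GrpObj X]

open scoped Pointwise in
/-- On a finite window `F` the kernel is the projection of a closed subset of a larger window, hence
constructible by Chevalley's theorem; being a subgroup, it is closed. -/
theorem isClosed_restr_windowKernel [IsAlgClosed k] [LocallyOfFiniteType X.hom]
    [QuasiCompact X.hom] [LocallyOfFiniteType Y.hom] {S : Set (G → Points X)}
    (hS : IsClosedAlgebraicGroupSubshift X S) {τ : S → G → Points Y} {M : Finset G}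
    {ν : restr S M → Points Y} (hν : IsLocalDefiningMap hS.isSubshift τ M ν)
    (hν' : IsAlgebraicHom X Y (restr S M) ν) (E : Finset G)
    (hsub : ∃ L : Subgroup (G → Points X), (L : Set (G → Points X)) = windowKernel τ E)
    (F : Finset G) : IsClosed (restr (windowKernel τ E) F) := by
  classical
  have hF : ∀ m ∈ M, ∀ e ∈ E, m * e ∈ F ∪ M * E := fun m hm e he =>
    Finset.mem_union_right _ (Finset.mul_mem_mul hm he)
  have hlarge : IsClosed (restr (windowKernel τ E) (F ∪ M * E)) := by
    rw [restr_windowKernel hν E _ hF]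
    exact (hS.isAlgebraicSubgroup _).isClosed.inter (isClosed_iInter fun e =>
      hν'.isClosed_ker.preimage (continuous_reindex X _))
  have hcons := isConstructible_image_reindex X
    (fun i : F => (⟨i, Finset.mem_union_left _ i.2⟩ : ↥(F ∪ M * E))) hlarge
  rw [← restr_eq_image_restr _ Finset.subset_union_left] at hcons
  obtain ⟨L, hL⟩ := hsub
  let ρ : (G → Points X) →* (F → Points X) :=
    { toFun := fun x i => x i, map_one' := rfl, map_mul' := fun _ _ => rfl }
  have hρ : ((L.map ρ : Subgroup (F → Points X)) : Set (F → Points X)) =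
      restr (windowKernel τ E) F := by
    rw [Subgroup.coe_map, hL]; rfl
  have := separatelyContinuousMul X F
  have := continuousInv X F
  rw [← hρ] at hcons ⊢
  exact isClosed_of_isConstructible_subgroup _ hcons

theorem exists_monoidHom_of_isAlgebraicHom (L : Subgroup (G → Points X))
    {hS : IsSubshift (L : Set (G → Points X))} {τ : ↥(L : Set (G → Points X)) → G → Points Y}
    {M : Finset G} {ν : restr (L : Set (G → Points X)) M → Points Y}
    (hν : IsLocalDefiningMap hS τ M ν) (hν' : IsAlgebraicHom X Y _ ν) :
    ∃ T : L →* (G → Points Y), ∀ x : L, T x = τ x :=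
  ⟨MonoidHom.mk' (fun x : L => τ x) fun a b => funext fun g => by
    rw [Pi.mul_apply, hν, hν, hν]
    exact hν'.map_mul _ _ _ rfl, fun _ => rfl⟩

/-- The inverse of an injective algebraic group cellular automaton has a finite memory set. -/
theorem exists_finset_determines [IsAlgClosed k] [Countable G] [LocallyOfFiniteType X.hom]
    [QuasiCompact X.hom] [LocallyOfFiniteType Y.hom] {S : Set (G → Points X)}
    (hS : IsClosedAlgebraicGroupSubshift X S) (τ : S → G → Points Y)
    (hτ : IsAlgebraicGroupCellularAutomaton X Y hS.isSubshift τ) (hinj : Function.Injective τ) :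
    ∃ N : Finset G, ∀ x y : S, (∀ n ∈ N, τ x n = τ y n) → x.1 1 = y.1 1 := by
  classical
  obtain ⟨M, ν, hν, hν'⟩ := hτ
  obtain ⟨L, rfl⟩ := exists_subgroup_of_forall_restr hS.isClosed hS.isAlgebraicSubgroup
  obtain ⟨T, hT⟩ := exists_monoidHom_of_isAlgebraicHom L hν hν'
  obtain rfl : (fun x => T x) = τ := funext hT
  obtain ⟨i, hi⟩ := Countable.exists_injective_nat G
  -- An increasing exhaustion of `G` by finite windows.
  let E : ℕ → Finset G := fun n => (Finset.range n).preimage i hi.injOn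
  have hE : ∀ m n, m ≤ n → E m ⊆ E n := fun m n hmn g hg => by
    simp only [E, Finset.mem_preimage, Finset.mem_range] at hg ⊢; omega
  let K : ℕ → Set (G → Points X) := fun n =>
    windowKernel (S := (L : Set (G → Points X))) (fun x => T x) (E n)
  have hanti : Antitone K :=
    fun m n hmn x ⟨hx, h⟩ => ⟨hx, fun e he => h e (hE m n hmn he)⟩
  have hstab : ∀ F : Finset G, ∃ n, ∀ m, n ≤ m → restr (K n) F = restr (K m) F := fun F =>
    have := noetherianSpace X F
    exists_forall_eq_of_antitone _ (fun m n hmn => Set.image_mono (hanti hmn)) fun n =>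
      isClosed_restr_windowKernel hS hν hν' (E n) (exists_subgroup_eq_windowKernel L T _) F
  have hn : ∃ n, ∀ x ∈ K n, x 1 = 1 := by
    by_contra! hcon
    -- A nontrivial symbol at `1` that occurs in the stable value occurs in every `K m`.
    obtain ⟨n, hn⟩ := hstab {1}
    obtain ⟨z, hz, hz1⟩ := hcon n
    obtain ⟨x, hx, hxz⟩ := exists_mem_forall_of_restr_stabilizes K hanti
      (fun n _ => mem_windowKernel_of_forall_restr hS.isClosed hν (E n)) hstab {1}
      (fun e => z e) fun m => by
        rcases le_total n m with h | h
        · exact hn m h ▸ ⟨z, hz, rfl⟩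
        · exact ⟨z, hanti h hz, rfl⟩
    have hxT : T ⟨x, (hx 0).1⟩ = T 1 := funext fun g => by
      rw [map_one]
      exact (hx (i g + 1)).2 g (by simp [E])
    have hx1 : x = 1 := congrArg Subtype.val (hinj hxT)
    refine hz1 ?_
    rw [← congrFun hxz ⟨1, Finset.mem_singleton_self 1⟩, hx1]
    rfl
  obtain ⟨n, hn⟩ := hn
  refine ⟨E n, fun x y hxy => ?_⟩
  have hdiv : (x.1 / y.1) ∈ K n := ⟨L.div_mem x.2 y.2, fun e he => by
    refine (congrFun (map_div T (⟨x.1, x.2⟩ : L) ⟨y.1, y.2⟩) e).trans ?_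
    exact div_eq_one.2 (hxy e he)⟩
  exact div_eq_one.1 (hn _ hdiv)

end Kernel

end SymbolicGroup

theorem theoremt {k : Type u} [Field k] [IsAlgClosed k] {G : Type v} [Monoid G] [Countable G]
    (X Y : Over (Spec (.of k))) [GrpObj X] [GrpObj Y]
    [LocallyOfFiniteType X.hom] [QuasiCompact X.hom]
    [LocallyOfFiniteType Y.hom] [QuasiCompact Y.hom]
    (S : Set (G → Points X)) (hS : IsClosedAlgebraicGroupSubshift X S)
    (τ : S → G → Points Y) (hτ : IsAlgebraicGroupCellularAutomaton X Y hS.isSubshift τ)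
    (hinj : Function.Injective τ)
    (Δ : Set (G → Points X)) (hΔ : IsSubshift Δ) (hΔS : Δ ⊆ S) :
    IsSubshift (imageOf τ Δ) ∧
      (IsFiniteType (imageOf τ Δ) ↔ IsFiniteType Δ) ∧
      (IsSofic (imageOf τ Δ) ↔ IsSofic Δ) := by
  obtain ⟨N, hN⟩ := exists_finset_determines hS τ hτ hinj
  have : Nonempty (Points X) := ⟨MonObj.one⟩
  have : Nonempty (Points Y) := ⟨MonObj.one⟩
  obtain ⟨M, ν, hν, -⟩ := hτ
  exact imageOf_iff_of_determined hS.isSubshift τ ⟨M, ν, hν⟩ N hN Δ hΔ hΔS
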